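/- Let $\mathbb{D}$ be the set of all regular (i.e. invertible) $2\times 2$ density matrices, that is, of all invertible positive semidefinite complex $2\times 2$ matrices with trace $1$, equipped with the operation $$A\odot B=\frac{\sqrt{A}\,B\,\sqrt{A}}{\operatorname{tr}\bigl(\sqrt{A}\,B\,\sqrt{A}\bigr)},$$ and let $\mathbb{P}_2^1$ be the set of all positive definite complex $2\times 2$ matrices with determinant $1$, equipped with the operation $$A\boxdot B=\sqrt{A}\,B\,\sqrt{A},$$ where $\sqrt{A}$ denotes the positive semidefinite square root of $A$. Both sets carry the topology inherited from the space of complex $2\times 2$ matrices. An automorphism of a set with a binary operation is a bijection of the set onto itself that preserves the operation. Then every automorphism of $(\mathbb{D},\odot)$ is continuous, and every automorphism of $(\mathbb{P}_2^1,\boxdot)$ is continuous. -/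

import Mathlib

open scoped ComplexOrder MatrixOrder

noncomputable section

/-- A self-map `f` of an algebraic structure `(X, op)` is an automorphism if it is a bijective
endomorphism. -/
structure IsAutomorphism {X : Type*} (op : X → X → X) (f : X → X) : Prop where
  map_op : ∀ x y, f (op x y) = op (f x) (f y)
  bijective : Function.Bijective f

/-- The sandwich product `√A B √A` of complex `2 × 2` matrices, where `√A` is the positive
semidefinite square root of `A`. -/
def sandwich (A B : Matrix (Fin 2) (Fin 2) ℂ) : Matrix (Fin 2) (Fin 2) ℂ :=
  CFC.sqrt A * B * CFC.sqrt A

theorem sandwich_posDef {A B : Matrix (Fin 2) (Fin 2) ℂ} (hA : A.PosDef) (hB : B.PosDef) :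
    (sandwich A B).PosDef := by
  have h0 : 0 ≤ A := hA.posSemidef.nonneg
  have hs : (CFC.sqrt A).IsHermitian := (CFC.sqrt_nonneg A).isSelfAdjoint
  have hu : IsUnit (CFC.sqrt A) := (CFC.isUnit_sqrt_iff A h0).2 hA.isUnit
  have h := (Matrix.IsUnit.posDef_star_left_conjugate_iff (x := B) hu).2 hB
  rwa [Matrix.star_eq_conjTranspose, hs.eq] at h

theorem sandwich_det {A B : Matrix (Fin 2) (Fin 2) ℂ} (hA : A.PosDef) :
    (sandwich A B).det = A.det * B.det := by
  have h : CFC.sqrt A * CFC.sqrt A = A := CFC.sqrt_mul_sqrt_self A hA.posSemidef.nonneg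
  rw [sandwich, Matrix.det_mul_comm, ← mul_assoc, h, Matrix.det_mul]

/-- The set of regular (i.e. invertible) complex `2 × 2` density matrices; a density matrix is a
positive semidefinite matrix of trace `1`. -/
def regularDensity : Set (Matrix (Fin 2) (Fin 2) ℂ) :=
  {A | A.PosSemidef ∧ A.trace = 1 ∧ IsUnit A}

/-- The set of positive definite complex `2 × 2` matrices of determinant `1`. -/
def posDefDetOne : Set (Matrix (Fin 2) (Fin 2) ℂ) :=
  {A | A.PosDef ∧ A.det = 1}

theorem mem_regularDensity_iff {A : Matrix (Fin 2) (Fin 2) ℂ} :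
    A ∈ regularDensity ↔ A.PosDef ∧ A.trace = 1 :=
  ⟨fun h => ⟨h.1.posDef_iff_isUnit.2 h.2.2, h.2.1⟩,
    fun h => ⟨h.1.posSemidef, h.2, h.1.isUnit⟩⟩

/-- The operation `A ⊙ B = √A B √A / tr (√A B √A)` on regular density matrices. -/
def densityOp (A B : regularDensity) : regularDensity :=
  ⟨(sandwich A B).trace⁻¹ • sandwich A B, by
    have h := sandwich_posDef (mem_regularDensity_iff.1 A.2).1 (mem_regularDensity_iff.1 B.2).1
    have ht : 0 < (sandwich A.1 B.1).trace := h.trace_pos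
    rw [mem_regularDensity_iff]
    refine ⟨h.smul (inv_pos.2 ht), ?_⟩
    rw [Matrix.trace_smul, smul_eq_mul, inv_mul_cancel₀ ht.ne']⟩

/-- The operation `A ⊡ B = √A B √A` on positive definite matrices of determinant `1`. -/
def posDefOp (A B : posDefDetOne) : posDefDetOne :=
  ⟨sandwich A B, sandwich_posDef A.2.1 B.2.1, by
    rw [sandwich_det A.2.1, A.2.2, B.2.2, mul_one]⟩

end

/-! Write `⊡` for `posDefOp` and let `f` respect it. Since `tr (X ⊡ Y) = tr (Y ⊡ X)`, the images of
`X ⊡ Y` and `Y ⊡ X` have equal trace. By `exists_posDefOp_eq`, every pair `A`, `B` of equal trace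
with `tr (A ⊡ B)` large enough has this form. Repeated squaring brings any pair with `B ≠ A⁻¹` into
that range, and inverses have equal trace, so `tr (f A)` depends only on `tr A` (`tr_map_eq`).

For the fixed element `halfTwo` and `A` of the same trace, `tr (halfTwo ⊡ A)` fills an interval `[2,
17/4]`; hence `tr ∘ f` is bounded on all elements with trace in that interval. Squaring multiplies
`tr - 2` by at least 4, so this bound forces `tr (f D) → 2` as `D → 1`, which is continuity at the
identity. Left multiplications carry it to every point, and rescaling transfers the result to
density matrices. -/

namespace PosDefTwo

open Matrix Filter Topology

/-! ### Trace and determinant identities for 2 × 2 matrices -/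

section CommRing
variable {K : Type*} [CommRing K]

theorem mul_self_eq (S : Matrix (Fin 2) (Fin 2) K) :
    S * S = S.trace • S - S.det • (1 : Matrix (Fin 2) (Fin 2) K) := by
  ext i j
  fin_cases i <;> fin_cases j <;>
    simp [Matrix.mul_apply, Fin.sum_univ_two, trace_fin_two, det_fin_two] <;> ring

theorem adjugate_eq (S : Matrix (Fin 2) (Fin 2) K) :
    S.adjugate = S.trace • (1 : Matrix (Fin 2) (Fin 2) K) - S := by
  ext i j
  fin_cases i <;> fin_cases j <;> simp [adjugate_fin_two, trace_fin_two]

/-- Multiply `S * R + adjugate (S * R) = tr (S * R)` on the right by `S`. -/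
theorem mul_mul_self_eq (S R : Matrix (Fin 2) (Fin 2) K) :
    S * R * S = (S * R).trace • S - S.det • R.adjugate := by
  ext i j
  fin_cases i <;> fin_cases j <;>
    simp [adjugate_fin_two, Matrix.mul_apply, Fin.sum_univ_two, trace_fin_two, det_fin_two] <;>
    ring

theorem trace_mul_self (S : Matrix (Fin 2) (Fin 2) K) :
    (S * S).trace = S.trace ^ 2 - 2 * S.det := by
  simp [Matrix.mul_apply, Fin.sum_univ_two, trace_fin_two, det_fin_two]
  ring

theorem trace_mul_add_trace_mul_adjugate (S R : Matrix (Fin 2) (Fin 2) K) :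
    (S * R).trace + (S * R.adjugate).trace = S.trace * R.trace := by
  simp [adjugate_fin_two, Matrix.mul_apply, Fin.sum_univ_two, trace_fin_two]
  ring

theorem det_combination (A B : Matrix (Fin 2) (Fin 2) K) (x y z : K) :
    (x • A + y • B + z • (1 : Matrix (Fin 2) (Fin 2) K)).det =
      x ^ 2 * A.det + y ^ 2 * B.det + z ^ 2 + x * y * (A.trace * B.trace - (A * B).trace)
        + x * z * A.trace + y * z * B.trace := by
  simp [Matrix.mul_apply, Fin.sum_univ_two, trace_fin_two, det_fin_two]
  ring

theorem trace_combination (A B : Matrix (Fin 2) (Fin 2) K) (x y z : K) :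
    (x • A + y • B + z • (1 : Matrix (Fin 2) (Fin 2) K)).trace =
      x * A.trace + y * B.trace + 2 * z := by
  simp [trace_fin_two]
  ring

theorem trace_combination_mul (A B : Matrix (Fin 2) (Fin 2) K) (x y z : K) :
    ((x • A + y • B + z • (1 : Matrix (Fin 2) (Fin 2) K)) *
      (x • B + y • A + z • (1 : Matrix (Fin 2) (Fin 2) K))).trace =
      x * y * ((A * A).trace + (B * B).trace) + (x ^ 2 + y ^ 2) * (A * B).trace
        + (x + y) * z * (A.trace + B.trace) + 2 * z ^ 2 := by
  simp [Matrix.mul_apply, Fin.sum_univ_two, trace_fin_two]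
  ring

theorem mul_sq_mul_eq (S R : Matrix (Fin 2) (Fin 2) K) {q t : K} (hS : S.det = 1) (hR : R.det = 1)
    (hSt : S.trace = q) (hRt : R.trace = q) (ht : (S * R).trace = t) :
    S * (R * R) * S = (q * (t - 1)) • S + q • R + (1 - q ^ 2) • (1 : Matrix (Fin 2) (Fin 2) K) := by
  have h1 : S * (R * R) * S = q • (S * R * S) - S * S := by
    rw [mul_self_eq R, hRt, hR, mul_sub, sub_mul, mul_smul_comm, smul_mul_assoc, one_smul, mul_one]
  rw [h1, mul_mul_self_eq, mul_self_eq S, adjugate_eq, hSt, hRt, hS, ht]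
  simp only [smul_sub, smul_smul]
  module

end CommRing

/-! ### Positive definite matrices of determinant one -/

theorem posDef_of_det_eq_one {M : Matrix (Fin 2) (Fin 2) ℂ} (hM : M.IsHermitian) (hd : M.det = 1)
    (ht : 0 < M.trace.re) : M.PosDef := by
  rw [hM.posDef_iff_eigenvalues_pos]
  have h1 := hM.det_eq_prod_eigenvalues
  have h2 := hM.trace_eq_sum_eigenvalues
  rw [hd, Fin.prod_univ_two] at h1
  rw [Fin.sum_univ_two] at h2
  rw [h2] at ht
  have h1' : (1 : ℝ) = hM.eigenvalues 0 * hM.eigenvalues 1 := by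
    simpa using congrArg Complex.re h1
  have ht' : 0 < hM.eigenvalues 0 + hM.eigenvalues 1 := by simpa using ht
  rw [Fin.forall_fin_two]
  constructor <;> nlinarith

theorem exists_real_entries {M : Matrix (Fin 2) (Fin 2) ℂ} (hM : M.PosDef) (hd : M.det = 1) :
    ∃ a d x y : ℝ, M = !![(a : ℂ), x + y * Complex.I; x - y * Complex.I, d] ∧
      a * d - x ^ 2 - y ^ 2 = 1 ∧ 0 < a ∧ 0 < d := by
  have h0 := hM.diag_pos (i := 0)
  have h1 := hM.diag_pos (i := 1)
  rw [Complex.pos_iff] at h0 h1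
  have e0 : M 0 0 = ((M 0 0).re : ℂ) := Complex.ext rfl (by simp [h0.2])
  have e1 : M 1 1 = ((M 1 1).re : ℂ) := Complex.ext rfl (by simp [h1.2])
  have e2 : M 1 0 = (M 0 1).re - (M 0 1).im * Complex.I := by
    rw [← hM.1.apply 1 0]
    apply Complex.ext <;> simp
  have hM' : M = !![((M 0 0).re : ℂ), (M 0 1).re + (M 0 1).im * Complex.I;
      (M 0 1).re - (M 0 1).im * Complex.I, (M 1 1).re] := by
    ext i j
    fin_cases i <;> fin_cases j
    · exact e0
    · simp
    · exact e2
    · exact e1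
  refine ⟨_, _, _, _, hM', ?_, h0.1, h1.1⟩
  rw [hM', det_fin_two] at hd
  have := congrArg Complex.re hd
  simp at this
  linarith

theorem trace_eq_re {M : Matrix (Fin 2) (Fin 2) ℂ} (hM : M.IsHermitian) :
    M.trace = (M.trace.re : ℂ) := by
  have h2 := hM.trace_eq_sum_eigenvalues
  rw [Fin.sum_univ_two] at h2
  rw [h2]
  simp

theorem two_le_trace {M : Matrix (Fin 2) (Fin 2) ℂ} (hM : M.PosDef) (hd : M.det = 1) :
    2 ≤ M.trace.re := by
  obtain ⟨a, d, x, y, rfl, h, ha, hd'⟩ := exists_real_entries hM hd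
  simp [trace_fin_two]
  nlinarith [sq_nonneg (a - d), sq_nonneg x, sq_nonneg y]

/-- The right side is the squared Frobenius norm of `M - 1`, so the trace alone controls the
distance to the identity. -/
theorem normSq_sub_one_apply_le {M : Matrix (Fin 2) (Fin 2) ℂ} (hM : M.PosDef) (hd : M.det = 1)
    (i j : Fin 2) :
    ‖M i j - (1 : Matrix (Fin 2) (Fin 2) ℂ) i j‖ ^ 2 ≤ M.trace.re * (M.trace.re - 2) := by
  obtain ⟨a, d, x, y, rfl, h, ha, hd'⟩ := exists_real_entries hM hd
  rw [← Complex.normSq_eq_norm_sq, Complex.normSq_apply]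
  fin_cases i <;> fin_cases j <;> simp [trace_fin_two] <;>
    nlinarith [sq_nonneg (a - 1), sq_nonneg (d - 1), sq_nonneg x, sq_nonneg y]

theorem eq_one_of_trace_eq_two {M : Matrix (Fin 2) (Fin 2) ℂ} (hM : M.PosDef) (hd : M.det = 1)
    (ht : M.trace.re = 2) : M = 1 := by
  ext i j
  have h := normSq_sub_one_apply_le hM hd i j
  rw [ht, sub_self, mul_zero] at h
  have h' : ‖M i j - (1 : Matrix (Fin 2) (Fin 2) ℂ) i j‖ = 0 := by
    nlinarith [norm_nonneg (M i j - (1 : Matrix (Fin 2) (Fin 2) ℂ) i j)]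
  exact sub_eq_zero.1 (norm_eq_zero.1 h')

theorem isHermitian_combination {A B : Matrix (Fin 2) (Fin 2) ℂ} (hA : A.IsHermitian)
    (hB : B.IsHermitian) (x y z : ℝ) :
    ((x : ℂ) • A + (y : ℂ) • B + (z : ℂ) • (1 : Matrix (Fin 2) (Fin 2) ℂ)).IsHermitian := by
  have h : ∀ r : ℝ, IsSelfAdjoint (r : ℂ) := fun r => Complex.conj_ofReal r
  exact (((h x).smul hA).add ((h y).smul hB)).add ((h z).smul (isHermitian_one))

/-! ### Factoring a pair of equal trace -/

/-- Two positive definite matrices of determinant one with the same trace that are not too far apart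
are the two sandwich products of a pair of positive definite matrices. -/
theorem exists_sandwich_factors {A B : Matrix (Fin 2) (Fin 2) ℂ} (hA : A.IsHermitian)
    (hB : B.IsHermitian) (hAd : A.det = 1) (hBd : B.det = 1) {q t : ℝ} (hq : 0 < q) (ht : 2 < t)
    (hAt : A.trace = ((2 + q ^ 2 * (t - 2) : ℝ) : ℂ))
    (hBt : B.trace = ((2 + q ^ 2 * (t - 2) : ℝ) : ℂ))
    (hAB : (A * B).trace = ((2 + q ^ 2 * (t - 2) * t ^ 2 : ℝ) : ℂ)) :
    ∃ S R : Matrix (Fin 2) (Fin 2) ℂ, S.PosDef ∧ R.PosDef ∧ S.det = 1 ∧ R.det = 1 ∧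
      S * (R * R) * S = A ∧ R * (S * S) * R = B := by
  -- By `mul_sq_mul_eq`, factors with `tr S = tr R = q` and `tr (S * R) = t` satisfy `A = q(t-1) S +
  -- q R + (1-q²)`, and symmetrically for `B`. Solving this linear system for `S` and `R` gives `x`,
  -- `y`, `z`.
  obtain ⟨k, hk⟩ : ∃ k : ℝ, k * (q * t * (t - 2)) = 1 :=
    ⟨(q * t * (t - 2))⁻¹, inv_mul_cancel₀ (by
      have : 0 < t - 2 := by linarith
      have : 0 < t := by linarith
      positivity)⟩
  have hkC : (k : ℂ) * (q * t * (t - 2)) = 1 := by exact_mod_cast hk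
  set x : ℝ := (t - 1) * k with hx
  set y : ℝ := -k with hy
  set z : ℝ := (q ^ 2 - 1) * (t - 2) * k with hz
  set S := (x : ℂ) • A + (y : ℂ) • B + (z : ℂ) • (1 : Matrix (Fin 2) (Fin 2) ℂ) with hS
  set R := (x : ℂ) • B + (y : ℂ) • A + (z : ℂ) • (1 : Matrix (Fin 2) (Fin 2) ℂ) with hR
  have hBA : (B * A).trace = ((2 + q ^ 2 * (t - 2) * t ^ 2 : ℝ) : ℂ) := by
    rw [trace_mul_comm, hAB]
  have hSt : S.trace = q := by
    rw [hS, trace_combination, hAt, hBt, hx, hy, hz]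
    push_cast
    linear_combination (q : ℂ) * hkC
  have hRt : R.trace = q := by
    rw [hR, trace_combination, hAt, hBt, hx, hy, hz]
    push_cast
    linear_combination (q : ℂ) * hkC
  have hSd : S.det = 1 := by
    rw [hS, det_combination, hAt, hBt, hAB, hAd, hBd, hx, hy, hz]
    push_cast
    linear_combination ((k : ℂ) * (q * t * (t - 2)) + 1) * hkC
  have hRd : R.det = 1 := by
    rw [hR, det_combination, hAt, hBt, hBA, hAd, hBd, hx, hy, hz]
    push_cast
    linear_combination ((k : ℂ) * (q * t * (t - 2)) + 1) * hkC
  have hSR : (S * R).trace = t := by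
    rw [hS, hR, trace_combination_mul, trace_mul_self, trace_mul_self, hAt, hBt, hAB, hAd, hBd, hx,
      hy, hz]
    push_cast
    linear_combination (t : ℂ) * ((k : ℂ) * (q * t * (t - 2)) + 1) * hkC
  have hRS : (R * S).trace = t := by rw [trace_mul_comm, hSR]
  have key : ∀ X Y : Matrix (Fin 2) (Fin 2) ℂ,
      ((q : ℂ) * (t - 1)) • ((x : ℂ) • X + (y : ℂ) • Y + (z : ℂ) • (1 : Matrix (Fin 2) (Fin 2) ℂ)) +
        (q : ℂ) • ((x : ℂ) • Y + (y : ℂ) • X + (z : ℂ) • (1 : Matrix (Fin 2) (Fin 2) ℂ)) +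
        (1 - (q : ℂ) ^ 2) • (1 : Matrix (Fin 2) (Fin 2) ℂ) = X := by
    intro X Y
    have e1 : (q : ℂ) * (t - 1) * x + q * y = 1 := by
      rw [hx, hy]; push_cast; linear_combination hkC
    have e2 : (q : ℂ) * (t - 1) * y + q * x = 0 := by
      rw [hx, hy]; push_cast; ring
    have e3 : (q : ℂ) * (t - 1) * z + q * z + (1 - q ^ 2) = 0 := by
      rw [hz]; push_cast; linear_combination ((q : ℂ) ^ 2 - 1) * hkC
    calc _ = ((q : ℂ) * (t - 1) * x + q * y) • X + ((q : ℂ) * (t - 1) * y + q * x) • Y +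
          ((q : ℂ) * (t - 1) * z + q * z + (1 - q ^ 2)) • (1 : Matrix (Fin 2) (Fin 2) ℂ) := by module
      _ = X := by rw [e1, e2, e3]; simp
  refine ⟨S, R, posDef_of_det_eq_one (isHermitian_combination hA hB _ _ _) hSd ?_,
    posDef_of_det_eq_one (isHermitian_combination hB hA _ _ _) hRd ?_, hSd, hRd, ?_, ?_⟩
  · simpa [hSt] using hq
  · simpa [hRt] using hq
  · rw [mul_sq_mul_eq S R hSd hRd hSt hRt hSR]
    exact key A B
  · rw [mul_sq_mul_eq R S hRd hSd hRt hSt hRS]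
    exact key B A

/-! ### Algebra of the sandwich product and its traces -/

theorem sandwich_mul_self {S : Matrix (Fin 2) (Fin 2) ℂ} (hS : S.PosDef)
    (B : Matrix (Fin 2) (Fin 2) ℂ) : sandwich (S * S) B = S * B * S := by
  rw [sandwich, CFC.sqrt_unique rfl hS.posSemidef.nonneg]

theorem trace_sandwich {A : Matrix (Fin 2) (Fin 2) ℂ} (hA : A.PosDef)
    (B : Matrix (Fin 2) (Fin 2) ℂ) : (sandwich A B).trace = (A * B).trace := by
  rw [sandwich, trace_mul_cycle, CFC.sqrt_mul_sqrt_self A hA.posSemidef.nonneg]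

theorem sandwich_self {A : Matrix (Fin 2) (Fin 2) ℂ} (hA : A.PosDef) : sandwich A A = A * A := by
  have h : CFC.sqrt A * CFC.sqrt A = A := CFC.sqrt_mul_sqrt_self A hA.posSemidef.nonneg
  calc sandwich A A = CFC.sqrt A * (CFC.sqrt A * CFC.sqrt A) * CFC.sqrt A := by rw [h, sandwich]
    _ = (CFC.sqrt A * CFC.sqrt A) * (CFC.sqrt A * CFC.sqrt A) := by simp only [mul_assoc]
    _ = A * A := by rw [h]

theorem sandwich_one (A : Matrix (Fin 2) (Fin 2) ℂ) (hA : A.PosDef) : sandwich A 1 = A := by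
  rw [sandwich, mul_one, CFC.sqrt_mul_sqrt_self A hA.posSemidef.nonneg]

theorem sqrt_inv {A : Matrix (Fin 2) (Fin 2) ℂ} (hA : A.PosDef) :
    CFC.sqrt A⁻¹ = (CFC.sqrt A)⁻¹ := by
  refine CFC.sqrt_unique ?_ ?_
  · rw [← Matrix.mul_inv_rev, CFC.sqrt_mul_sqrt_self A hA.posSemidef.nonneg]
  · exact (nonneg_iff_posSemidef.1 (CFC.sqrt_nonneg A)).inv.nonneg

theorem isUnit_det_sqrt {A : Matrix (Fin 2) (Fin 2) ℂ} (hA : A.PosDef) :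
    IsUnit (CFC.sqrt A).det :=
  (isUnit_iff_isUnit_det _).1 ((CFC.isUnit_sqrt_iff A hA.posSemidef.nonneg).2 hA.isUnit)

theorem sandwich_sandwich_inv {A : Matrix (Fin 2) (Fin 2) ℂ} (hA : A.PosDef)
    (B : Matrix (Fin 2) (Fin 2) ℂ) : sandwich A (sandwich A⁻¹ B) = B := by
  have h := isUnit_det_sqrt hA
  rw [sandwich, sandwich, sqrt_inv hA, mul_assoc, mul_assoc, mul_assoc, nonsing_inv_mul _ h,
    mul_one, ← mul_assoc, mul_nonsing_inv _ h, one_mul]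

theorem sandwich_inv_sandwich {A : Matrix (Fin 2) (Fin 2) ℂ} (hA : A.PosDef)
    (B : Matrix (Fin 2) (Fin 2) ℂ) : sandwich A⁻¹ (sandwich A B) = B := by
  have h := sandwich_sandwich_inv hA.inv B
  rwa [nonsing_inv_nonsing_inv _ ((isUnit_iff_isUnit_det _).1 hA.isUnit)] at h

theorem inv_eq_adjugate {A : Matrix (Fin 2) (Fin 2) ℂ} (hA : A.det = 1) : A⁻¹ = A.adjugate := by
  rw [inv_def, hA, Ring.inverse_one, one_smul]

/-- The identity matrix as a positive definite matrix of determinant one. -/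
def one : posDefDetOne := ⟨1, PosDef.one, det_one⟩

/-- The inverse of a positive definite matrix of determinant one. -/
noncomputable def inv (A : posDefDetOne) : posDefDetOne :=
  ⟨A.1⁻¹, A.2.1.inv, by rw [inv_eq_adjugate A.2.2, det_adjugate, A.2.2, one_pow]⟩

/-- The trace of a positive definite matrix of determinant one, as a real number. -/
noncomputable def tr (A : posDefDetOne) : ℝ := A.1.trace.re

theorem two_le_tr (A : posDefDetOne) : 2 ≤ tr A := two_le_trace A.2.1 A.2.2

theorem trace_eq_tr (A : posDefDetOne) : A.1.trace = (tr A : ℂ) := trace_eq_re A.2.1.1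

theorem eq_one_of_tr_eq_two {A : posDefDetOne} (h : tr A = 2) : A = one :=
  Subtype.ext (eq_one_of_trace_eq_two A.2.1 A.2.2 h)

theorem trace_mul_eq_tr (A B : posDefDetOne) : (A.1 * B.1).trace = (tr (posDefOp A B) : ℂ) := by
  rw [← trace_eq_tr, ← trace_sandwich A.2.1]
  rfl

theorem tr_posDefOp_comm (A B : posDefDetOne) : tr (posDefOp A B) = tr (posDefOp B A) := by
  have h := trace_mul_eq_tr A B
  rw [trace_mul_comm, trace_mul_eq_tr] at h
  exact_mod_cast h.symm

theorem posDefOp_self_val (A : posDefDetOne) : (posDefOp A A).1 = A.1 * A.1 := sandwich_self A.2.1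

theorem tr_posDefOp_self (A : posDefDetOne) : tr (posDefOp A A) = tr A ^ 2 - 2 := by
  have h := trace_mul_eq_tr A A
  rw [trace_mul_self, A.2.2, trace_eq_tr] at h
  have h' : tr A ^ 2 - 2 * 1 = tr (posDefOp A A) := by exact_mod_cast h
  linarith

theorem tr_inv (A : posDefDetOne) : tr (inv A) = tr A := by
  simp only [tr, inv]
  rw [inv_eq_adjugate A.2.2, adjugate_fin_two, trace_fin_two, trace_fin_two]
  simp [add_comm]

/-- The defect `tr A * tr B - tr (A ⊡ B)` is `tr (A ⊡ B⁻¹)`, which is positive. -/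
theorem tr_posDefOp_le (A B : posDefDetOne) : tr (posDefOp A B) ≤ tr A * tr B := by
  have h := trace_mul_add_trace_mul_adjugate A.1 B.1
  have hB : B.1.adjugate = (inv B).1 := (inv_eq_adjugate B.2.2).symm
  rw [hB, trace_mul_eq_tr, trace_mul_eq_tr, trace_eq_tr, trace_eq_tr] at h
  have h' : tr (posDefOp A B) + tr (posDefOp A (inv B)) = tr A * tr B := by exact_mod_cast h
  linarith [two_le_tr (posDefOp A (inv B))]

theorem posDefOp_one (A : posDefDetOne) : posDefOp A one = A :=
  Subtype.ext (sandwich_one A.1 A.2.1)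

theorem posDefOp_posDefOp_inv (A B : posDefDetOne) : posDefOp A (posDefOp (inv A) B) = B :=
  Subtype.ext (sandwich_sandwich_inv A.2.1 B.1)

theorem posDefOp_inv_posDefOp (A B : posDefDetOne) : posDefOp (inv A) (posDefOp A B) = B :=
  Subtype.ext (sandwich_inv_sandwich A.2.1 B.1)

theorem posDefOp_left_cancel {A B C : posDefDetOne} (h : posDefOp A B = posDefOp A C) : B = C := by
  rw [← posDefOp_inv_posDefOp A B, h, posDefOp_inv_posDefOp]

theorem posDefOp_inv_self (A : posDefDetOne) : posDefOp A (inv A) = one := by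
  apply posDefOp_left_cancel (A := inv A)
  rw [posDefOp_inv_posDefOp, posDefOp_one]

theorem tr_posDefOp_self_posDefOp_self {A B : posDefDetOne} (h : tr A = tr B) :
    tr (posDefOp (posDefOp A A) (posDefOp B B)) - 2 = tr A ^ 2 * (tr (posDefOp A B) - 2) := by
  have e := trace_mul_eq_tr (posDefOp A A) (posDefOp B B)
  rw [posDefOp_self_val, posDefOp_self_val, mul_self_eq, mul_self_eq, A.2.2, B.2.2, one_smul,
    sub_mul, mul_sub, mul_sub, one_mul, one_mul, mul_one, smul_mul_smul_comm, trace_sub, trace_sub,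
    trace_sub, trace_smul, trace_smul, trace_smul, trace_mul_eq_tr, trace_eq_tr, trace_eq_tr,
    trace_one, ← h] at e
  simp only [smul_eq_mul, Fintype.card_fin] at e
  have e' : tr A * tr A * tr (posDefOp A B) - tr A * tr A - (tr A * tr A - (2 : ℕ)) =
    tr (posDefOp (posDefOp A A) (posDefOp B B)) := by exact_mod_cast e
  rw [← e']
  push_cast
  ring

/-- Two elements of the same trace that are not too far apart arise as `X ⊡ Y` and `Y ⊡ X`. -/
theorem exists_posDefOp_eq {A B : posDefDetOne} (h : tr A = tr B) (hA : 2 < tr A)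
    (hAB : 4 * (tr A - 2) < tr (posDefOp A B) - 2) :
    ∃ X Y : posDefDetOne, posDefOp X Y = A ∧ posDefOp Y X = B := by
  set u := tr A - 2 with hu
  set e := tr (posDefOp A B) - 2 with he
  have hu0 : 0 < u := by linarith
  have he0 : 0 < e := by linarith
  -- `t` and `q` solve `u = q²(t-2)` and `e = u t²`; the bound `4u < e` says exactly `t > 2`.
  set t := √(e / u) with ht
  have htt : t ^ 2 = e / u := Real.sq_sqrt (by positivity)
  have ht2 : 2 < t := by
    rw [ht, Real.lt_sqrt (by norm_num), lt_div_iff₀ hu0]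
    linarith
  have hpos : 0 < t - 2 := by linarith
  set q := √(u / (t - 2)) with hq
  have hqq : q ^ 2 * (t - 2) = u := by
    rw [hq, Real.sq_sqrt (by positivity), div_mul_cancel₀ _ hpos.ne']
  have hq0 : 0 < q := Real.sqrt_pos.2 (by positivity)
  have e1 : tr A = 2 + q ^ 2 * (t - 2) := by rw [hqq]; linarith
  have e2 : tr (posDefOp A B) = 2 + q ^ 2 * (t - 2) * t ^ 2 := by
    rw [hqq, htt, mul_div_cancel₀ _ hu0.ne']; linarith
  obtain ⟨S, R, hS, hR, hSd, hRd, h1, h2⟩ := exists_sandwich_factors A.2.1.1 B.2.1.1 A.2.2 B.2.2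
    hq0 ht2 (by rw [trace_eq_tr, e1]) (by rw [trace_eq_tr, ← h, e1]) (by rw [trace_mul_eq_tr, e2])
  set S' : posDefDetOne := ⟨S, hS, hSd⟩
  set R' : posDefDetOne := ⟨R, hR, hRd⟩
  refine ⟨posDefOp S' S', posDefOp R' R', Subtype.ext ?_, Subtype.ext ?_⟩
  · change sandwich (posDefOp S' S').1 (posDefOp R' R').1 = A.1
    rw [posDefOp_self_val, posDefOp_self_val, sandwich_mul_self hS, ← h1]
  · change sandwich (posDefOp R' R').1 (posDefOp S' S').1 = B.1
    rw [posDefOp_self_val, posDefOp_self_val, sandwich_mul_self hR, ← h2]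

/-! ### The trace of an image depends only on the trace -/

theorem map_one {f : posDefDetOne → posDefDetOne}
    (hf : ∀ A B, f (posDefOp A B) = posDefOp (f A) (f B)) : f one = one := by
  apply posDefOp_left_cancel (A := f one)
  rw [← hf, posDefOp_one, posDefOp_one]

theorem map_inv {f : posDefDetOne → posDefDetOne}
    (hf : ∀ A B, f (posDefOp A B) = posDefOp (f A) (f B)) (A : posDefDetOne) :
    f (inv A) = inv (f A) := by
  apply posDefOp_left_cancel (A := f A)
  rw [← hf, posDefOp_inv_self, posDefOp_inv_self, map_one hf]

/-- With `u = tr A - 2` and `e = tr (A ⊡ B) - 2`, squaring both matrices preserves `e / (u(u+4))`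
and sends `u` to `u(u+4) ≥ 4u`. The hypothesis thus ensures `e > 4u` after `n` squarings, where
`exists_posDefOp_eq` applies. -/
theorem tr_map_eq_of_lt {f : posDefDetOne → posDefDetOne}
    (hf : ∀ A B, f (posDefOp A B) = posDefOp (f A) (f B)) (n : ℕ) :
    ∀ {A B : posDefDetOne}, tr A = tr B → 2 < tr A →
      4 * (tr A - 2) * (tr A + 2) < (tr (posDefOp A B) - 2) * (4 ^ n * (tr A - 2) + 4) →
      tr (f A) = tr (f B) := by
  induction n with
  | zero =>
    intro A B h hA hAB
    obtain ⟨X, Y, rfl, rfl⟩ := exists_posDefOp_eq h hA (by nlinarith)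
    rw [hf, hf, tr_posDefOp_comm]
  | succ n ih =>
    intro A B h hA hAB
    have h1 : tr (f (posDefOp A A)) = tr (f (posDefOp B B)) := by
      apply ih
      · rw [tr_posDefOp_self, tr_posDefOp_self, h]
      · rw [tr_posDefOp_self]; nlinarith
      · rw [tr_posDefOp_self_posDefOp_self h, tr_posDefOp_self]
        set u := tr A - 2 with hu
        set e := tr (posDefOp A B) - 2
        have e1 : tr A = u + 2 := by rw [hu]; ring
        rw [e1] at hAB ⊢
        have hu0 : 0 < u := by linarith
        have he0 : 0 ≤ e := by linarith [two_le_tr (posDefOp A B)]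
        have h2 : e * (4 ^ (n + 1) * u + 4) ≤ e * (4 ^ n * (u * (u + 4)) + 4) := by
          apply mul_le_mul_of_nonneg_left _ he0
          have : (0 : ℝ) ≤ 4 ^ n * (u * u) := by positivity
          rw [pow_succ]
          linarith
        have h3 := mul_lt_mul_of_pos_left (hAB.trans_le h2) (show 0 < (u + 2) ^ 2 by positivity)
        calc _ = (u + 2) ^ 2 * (4 * u * (u + 2 + 2)) := by ring
          _ < _ := h3
          _ = _ := by ring
    rw [hf, hf, tr_posDefOp_self, tr_posDefOp_self] at h1
    -- Undo the squaring: `tr (X ⊡ X) = (tr X)² - 2` determines `tr X`, which is positive.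
    have h2 : (tr (f A) - tr (f B)) * (tr (f A) + tr (f B)) = 0 := by linarith
    have h3 : tr (f A) + tr (f B) ≠ 0 := by linarith [two_le_tr (f A), two_le_tr (f B)]
    exact sub_eq_zero.1 ((mul_eq_zero.1 h2).resolve_right h3)

/-- The trace of the image under an endomorphism depends only on the trace. -/
theorem tr_map_eq {f : posDefDetOne → posDefDetOne}
    (hf : ∀ A B, f (posDefOp A B) = posDefOp (f A) (f B)) {A B : posDefDetOne}
    (h : tr A = tr B) : tr (f A) = tr (f B) := by
  rcases (two_le_tr A).eq_or_lt with hA | hA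
  · rw [eq_one_of_tr_eq_two hA.symm, eq_one_of_tr_eq_two (A := B) (by rw [← h, hA])]
  rcases (two_le_tr (posDefOp A B)).eq_or_lt with hAB | hAB
  -- Here `B = A⁻¹`, the one case squaring cannot improve.
  · have h1 : posDefOp A B = posDefOp A (inv A) := by
      rw [posDefOp_inv_self, eq_one_of_tr_eq_two hAB.symm]
    rw [posDefOp_left_cancel h1, map_inv hf, tr_inv]
  · have he : 0 < tr (posDefOp A B) - 2 := by linarith
    have hu : 0 < tr A - 2 := by linarith
    obtain ⟨n, hn⟩ := pow_unbounded_of_one_lt (4 * (tr A + 2) / (tr (posDefOp A B) - 2))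
      (show (1 : ℝ) < 4 by norm_num)
    refine tr_map_eq_of_lt hf n h hA ?_
    rw [div_lt_iff₀ he] at hn
    have := mul_lt_mul_of_pos_right hn hu
    nlinarith

/-! ### Boundedness near the identity -/

/-- The element `diag(1/2, 2)`. -/
noncomputable def halfTwo : posDefDetOne :=
  ⟨!![1 / 2, 0; 0, 2], by
    have hd : (!![1 / 2, 0; 0, 2] : Matrix (Fin 2) (Fin 2) ℂ).det = 1 := by
      rw [det_fin_two_of]; norm_num
    refine ⟨posDef_of_det_eq_one ?_ hd ?_, hd⟩
    · ext i j
      fin_cases i <;> fin_cases j <;> simp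
    · rw [trace_fin_two_of]; norm_num⟩

theorem tr_halfTwo : tr halfTwo = 5 / 2 := by
  simp only [tr, halfTwo, trace_fin_two_of]
  norm_num

/-- The endpoints come from `A = halfTwo⁻¹` and `A = halfTwo`, with `17/4 = (5/2)² - 2`; rotating
between them gives the rest. -/
theorem exists_tr_halfTwo_posDefOp {t : ℝ} (ht : 2 ≤ t) (ht' : t ≤ 17 / 4) :
    ∃ A : posDefDetOne, tr A = tr halfTwo ∧ tr (posDefOp halfTwo A) = t := by
  -- Solves `a/2 + 2(5/2 - a) = t`; then `b` makes the determinant 1.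
  set a : ℝ := (5 - t) * 2 / 3 with ha
  set b : ℝ := √(a * (5 / 2 - a) - 1) with hb
  have hbb : b * b = a * (5 / 2 - a) - 1 := Real.mul_self_sqrt (by rw [ha]; nlinarith)
  have hbbC : (b : ℂ) * b = a * (5 / 2 - a) - 1 := by
    rw [← Complex.ofReal_mul, hbb]
    push_cast
    ring
  have hd : (!![(a : ℂ), b; b, 5 / 2 - a] : Matrix (Fin 2) (Fin 2) ℂ).det = 1 := by
    rw [det_fin_two_of, hbbC]; ring
  have htr : (!![(a : ℂ), b; b, 5 / 2 - a] : Matrix (Fin 2) (Fin 2) ℂ).trace = (5 / 2 : ℝ) := by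
    rw [trace_fin_two_of]; push_cast; ring
  have hh : (!![(a : ℂ), b; b, 5 / 2 - a] : Matrix (Fin 2) (Fin 2) ℂ).IsHermitian := by
    ext i j
    fin_cases i <;> fin_cases j <;> simp
  let A : posDefDetOne := ⟨_, posDef_of_det_eq_one hh hd (by rw [htr]; norm_num), hd⟩
  refine ⟨A, ?_, ?_⟩
  · rw [tr_halfTwo, tr]
    change (trace !![(a : ℂ), b; b, 5 / 2 - a]).re = 5 / 2
    rw [htr, Complex.ofReal_re]
  · have h := trace_mul_eq_tr halfTwo A
    have h2 : (halfTwo.1 * A.1).trace = (t : ℂ) := by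
      change (!![1 / 2, 0; 0, 2] * !![(a : ℂ), b; b, 5 / 2 - a] : Matrix (Fin 2) (Fin 2) ℂ).trace = t
      rw [mul_fin_two, trace_fin_two_of, ha]
      push_cast
      ring
    rw [h2] at h
    exact_mod_cast h.symm

theorem tr_map_le {f : posDefDetOne → posDefDetOne}
    (hf : ∀ A B, f (posDefOp A B) = posDefOp (f A) (f B)) {D : posDefDetOne}
    (hD : tr D ≤ 17 / 4) : tr (f D) ≤ tr (f halfTwo) ^ 2 := by
  obtain ⟨A, hA, hAD⟩ := exists_tr_halfTwo_posDefOp (two_le_tr D) hD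
  calc tr (f D) = tr (posDefOp (f halfTwo) (f A)) := by rw [← tr_map_eq hf hAD, hf]
    _ ≤ tr (f halfTwo) * tr (f A) := tr_posDefOp_le _ _
    _ = tr (f halfTwo) ^ 2 := by rw [tr_map_eq hf hA, sq]

/-- Each squaring multiplies `tr (f D) - 2` by `tr (f D) + 2 ≥ 4`. -/
theorem four_pow_mul_tr_map_le {f : posDefDetOne → posDefDetOne}
    (hf : ∀ A B, f (posDefOp A B) = posDefOp (f A) (f B)) (n : ℕ) :
    ∀ D : posDefDetOne, tr ((fun X => posDefOp X X)^[n] D) ≤ 17 / 4 →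
      4 ^ n * (tr (f D) - 2) ≤ tr (f halfTwo) ^ 2 - 2 := by
  induction n with
  | zero =>
    intro D hD
    rw [pow_zero, one_mul]
    exact sub_le_sub_right (tr_map_le hf hD) 2
  | succ n ih =>
    intro D hD
    refine le_trans ?_ (ih (posDefOp D D) hD)
    rw [hf, tr_posDefOp_self, pow_succ, mul_assoc]
    have := two_le_tr (f D)
    gcongr
    nlinarith

/-! ### Continuity at the identity, then everywhere -/

theorem continuous_tr : Continuous tr :=
  Complex.continuous_re.comp (continuous_subtype_val.matrix_trace)

theorem continuous_posDefOp_self : Continuous fun X : posDefDetOne => posDefOp X X := by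
  refine Continuous.subtype_mk (f := fun X : posDefDetOne => sandwich X.1 X.1) ?_ _
  have h : (fun X : posDefDetOne => sandwich X.1 X.1) = fun X => X.1 * X.1 :=
    funext fun X => sandwich_self X.2.1
  rw [h]
  exact continuous_subtype_val.mul continuous_subtype_val

theorem continuous_posDefOp_right (A : posDefDetOne) : Continuous (posDefOp A) :=
  Continuous.subtype_mk ((continuous_const.mul continuous_subtype_val).mul continuous_const) _

theorem tr_one : tr one = 2 := by simp [tr, one]

theorem tendsto_one_of_tendsto_tr {ι : Type*} {l : Filter ι} {g : ι → posDefDetOne}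
    (h : Tendsto (fun i => tr (g i)) l (𝓝 2)) : Tendsto g l (𝓝 one) := by
  rw [tendsto_subtype_rng]
  refine tendsto_pi_nhds.2 fun i => tendsto_pi_nhds.2 fun j => ?_
  rw [tendsto_iff_norm_sub_tendsto_zero]
  have h1 : Tendsto (fun k => √(tr (g k) * (tr (g k) - 2))) l (𝓝 0) := by
    have := (h.mul (h.sub_const 2)).sqrt
    simpa using this
  refine squeeze_zero (fun _ => norm_nonneg _) (fun k => ?_) h1
  exact Real.le_sqrt_of_sq_le (normSq_sub_one_apply_le (g k).2.1 (g k).2.2 i j)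

theorem tendsto_map_one {f : posDefDetOne → posDefDetOne}
    (hf : ∀ A B, f (posDefOp A B) = posDefOp (f A) (f B)) : Tendsto f (𝓝 one) (𝓝 one) := by
  apply tendsto_one_of_tendsto_tr
  rw [tendsto_order]
  refine ⟨fun a ha => Eventually.of_forall fun D => ha.trans_le (two_le_tr _), fun a ha => ?_⟩
  obtain ⟨n, hn⟩ := pow_unbounded_of_one_lt ((tr (f halfTwo) ^ 2 - 2) / (a - 2))
    (show (1 : ℝ) < 4 by norm_num)
  have hc : Continuous fun D => tr ((fun X => posDefOp X X)^[n] D) :=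
    continuous_tr.comp (continuous_posDefOp_self.iterate n)
  have h1 : tr ((fun X => posDefOp X X)^[n] one) < 17 / 4 := by
    rw [Function.iterate_fixed (f := fun X => posDefOp X X) (posDefOp_one one), tr_one]; norm_num
  filter_upwards [hc.continuousAt.eventually_lt continuousAt_const h1] with D hD
  have h2 := four_pow_mul_tr_map_le hf n D hD.le
  rw [div_lt_iff₀ (by linarith)] at hn
  have h3 : tr (f D) - 2 < a - 2 := lt_of_mul_lt_mul_left (h2.trans_lt hn) (by positivity)
  linarith

/-- Every endomorphism of the positive definite matrices of determinant one is continuous. -/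
theorem continuous_of_map_posDefOp {f : posDefDetOne → posDefDetOne}
    (hf : ∀ A B, f (posDefOp A B) = posDefOp (f A) (f B)) : Continuous f := by
  rw [continuous_iff_continuousAt]
  intro A
  have h1 : Tendsto (posDefOp (inv A)) (𝓝 A) (𝓝 one) := by
    have h := (continuous_posDefOp_right (inv A)).tendsto A
    have e : posDefOp (inv A) A = one := by
      simpa only [posDefOp_one] using posDefOp_inv_posDefOp A one
    rwa [e] at h
  -- Uses `f B = f A ⊡ f (A⁻¹ ⊡ B)`, where `A⁻¹ ⊡ B → 1` as `B → A`.
  have h2 := ((continuous_posDefOp_right (f A)).tendsto one).comp ((tendsto_map_one hf).comp h1)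
  rw [posDefOp_one] at h2
  refine h2.congr fun B => ?_
  simp only [Function.comp_apply]
  rw [← hf, posDefOp_posDefOp_inv]

/-! ### Transfer to density matrices by rescaling -/

/-- The density matrix proportional to a positive definite matrix of determinant one. -/
noncomputable def toDensity (M : posDefDetOne) : regularDensity :=
  ⟨M.1.trace⁻¹ • M.1, by
    have ht : 0 < M.1.trace := M.2.1.trace_pos
    rw [mem_regularDensity_iff]
    refine ⟨M.2.1.smul (inv_pos.2 ht), ?_⟩
    rw [Matrix.trace_smul, smul_eq_mul, inv_mul_cancel₀ ht.ne']⟩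

theorem det_eq_re {M : Matrix (Fin 2) (Fin 2) ℂ} (hM : M.PosDef) :
    M.det = (M.det.re : ℂ) ∧ 0 < M.det.re := by
  have h := Complex.pos_iff.1 hM.det_pos
  exact ⟨Complex.ext rfl (by simp [h.2]), h.1⟩

/-- The positive definite matrix of determinant one proportional to a regular density matrix. -/
noncomputable def ofDensity (A : regularDensity) : posDefDetOne :=
  ⟨((√A.1.det.re)⁻¹ : ℝ) • A.1, by
    have hA := (mem_regularDensity_iff.1 A.2).1
    obtain ⟨h, h0⟩ := det_eq_re hA
    have hs : 0 < (√A.1.det.re)⁻¹ := inv_pos.2 (Real.sqrt_pos.2 h0)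
    refine ⟨hA.smul hs, ?_⟩
    have e : ((√A.1.det.re)⁻¹ : ℝ) ^ 2 * A.1.det.re = 1 := by
      rw [inv_pow, Real.sq_sqrt h0.le, inv_mul_cancel₀ h0.ne']
    rw [det_smul_of_tower, Fintype.card_fin, h, Complex.real_smul]
    exact_mod_cast e⟩

theorem toDensity_ofDensity (A : regularDensity) : toDensity (ofDensity A) = A := by
  have hA := mem_regularDensity_iff.1 A.2
  have hs : (√A.1.det.re)⁻¹ ≠ 0 := (inv_pos.2 (Real.sqrt_pos.2 (det_eq_re hA.1).2)).ne'
  apply Subtype.ext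
  simp only [toDensity, ofDensity]
  rw [trace_smul, hA.2, Complex.real_smul, mul_one, ← Complex.coe_smul, smul_smul,
    inv_mul_cancel₀ (by exact_mod_cast hs), one_smul]

theorem ofDensity_toDensity (M : posDefDetOne) : ofDensity (toDensity M) = M := by
  have ht : 0 < tr M := by linarith [two_le_tr M]
  apply Subtype.ext
  simp only [toDensity, ofDensity]
  rw [det_smul, M.2.2, trace_eq_tr, mul_one, Fintype.card_fin, ← Complex.ofReal_inv,
    ← Complex.ofReal_pow, Complex.ofReal_re, Real.sqrt_sq (inv_pos.2 ht).le, inv_inv,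
    Complex.coe_smul, smul_smul, mul_inv_cancel₀ ht.ne', one_smul]

theorem sandwich_smul {c : ℝ} (hc : 0 ≤ c) (d : ℂ) {A : Matrix (Fin 2) (Fin 2) ℂ} (hA : A.PosDef)
    (B : Matrix (Fin 2) (Fin 2) ℂ) : sandwich (c • A) (d • B) = (c * d : ℂ) • sandwich A B := by
  have h : CFC.sqrt (c • A) = √c • CFC.sqrt A := by
    refine CFC.sqrt_unique ?_ (smul_nonneg (Real.sqrt_nonneg c) (CFC.sqrt_nonneg A))
    rw [smul_mul_smul_comm, Real.mul_self_sqrt hc, CFC.sqrt_mul_sqrt_self A hA.posSemidef.nonneg]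
  rw [sandwich, h, ← Complex.coe_smul, smul_mul_smul_comm, smul_mul_smul_comm, sandwich]
  congr 1
  rw [mul_right_comm, ← Complex.ofReal_mul, Real.mul_self_sqrt hc]

theorem toDensity_posDefOp (A B : posDefDetOne) :
    toDensity (posDefOp A B) = densityOp (toDensity A) (toDensity B) := by
  have hA : 0 < tr A := by linarith [two_le_tr A]
  have hB : 0 < tr B := by linarith [two_le_tr B]
  apply Subtype.ext
  simp only [toDensity, densityOp, posDefOp]
  rw [trace_eq_tr A, ← Complex.ofReal_inv, Complex.coe_smul,
    sandwich_smul (inv_pos.2 hA).le _ A.2.1, trace_smul, smul_smul]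
  congr 1
  have hA' : (tr A : ℂ) ≠ 0 := by exact_mod_cast hA.ne'
  have hB' : (tr B : ℂ) ≠ 0 := by exact_mod_cast hB.ne'
  rw [trace_eq_tr B, smul_eq_mul]
  push_cast
  rw [_root_.mul_inv_rev, inv_mul_cancel_right₀ (mul_ne_zero (inv_ne_zero hA') (inv_ne_zero hB'))]

theorem ofDensity_densityOp (A B : regularDensity) :
    ofDensity (densityOp A B) = posDefOp (ofDensity A) (ofDensity B) := by
  rw [← ofDensity_toDensity (posDefOp _ _), toDensity_posDefOp, toDensity_ofDensity,
    toDensity_ofDensity]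

theorem continuous_toDensity : Continuous toDensity := by
  have h : Continuous fun M : posDefDetOne => M.1.trace⁻¹ :=
    continuous_subtype_val.matrix_trace.inv₀ fun M => M.2.1.trace_pos.ne'
  exact (h.smul continuous_subtype_val).subtype_mk _

theorem continuous_ofDensity : Continuous ofDensity := by
  have h : Continuous fun A : regularDensity => (√A.1.det.re)⁻¹ :=
    (Complex.continuous_re.comp continuous_subtype_val.matrix_det).sqrt.inv₀ fun A =>
      (Real.sqrt_pos.2 (det_eq_re (mem_regularDensity_iff.1 A.2).1).2).ne'
  exact (h.smul continuous_subtype_val).subtype_mk _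

/-- Every endomorphism of the regular density matrices is continuous. -/
theorem continuous_of_map_densityOp {f : regularDensity → regularDensity}
    (hf : ∀ A B, f (densityOp A B) = densityOp (f A) (f B)) : Continuous f := by
  have h : Continuous (ofDensity ∘ f ∘ toDensity) := continuous_of_map_posDefOp fun A B => by
    simp only [Function.comp_apply, toDensity_posDefOp, hf, ofDensity_densityOp]
  have h' : f = toDensity ∘ (ofDensity ∘ f ∘ toDensity) ∘ ofDensity := by
    funext A
    simp only [Function.comp_apply, toDensity_ofDensity]
  rw [h']
  exact continuous_toDensity.comp (h.comp continuous_ofDensity)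

end PosDefTwo

theorem mainTheorem3 :
    (∀ f : regularDensity → regularDensity, IsAutomorphism densityOp f → Continuous f) ∧
      (∀ f : posDefDetOne → posDefDetOne, IsAutomorphism posDefOp f → Continuous f) :=
  ⟨fun _ hf => PosDefTwo.continuous_of_map_densityOp hf.map_op,
    fun _ hf => PosDefTwo.continuous_of_map_posDefOp hf.map_op⟩
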